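/- Let $\mathbf{A}$ be a finite Boolean algebra and let $P:\mathbf{A}\to[0,1]$ be a positive probability, that is, $P(\top)=1$, $P(a\vee b)=P(a)+P(b)$ whenever $a\wedge b=\bot$, and $P(a)>0$ for every $a\neq\bot$. The Boolean algebra of conditionals $\mathcal{C}(\mathbf{A})$ is the quotient of the free Boolean algebra (with operations $\sqcap,\sqcup,\sim$ and top $\top^*$) generated by the formal pairs $(a\mid b)$, $a\in \mathbf{A}$, $b\in \mathbf{A}\setminus\{\bot\}$, by the congruence generated by the identifications: $(b\mid b)\equiv\top^*$; $(a_1\mid b)\sqcap(a_2\mid b)\equiv(a_1\wedge a_2\mid b)$; $\sim(a\mid b)\equiv(\neg a\mid b)$; $(a\wedge b\mid b)\equiv(a\mid b)$; and $(a\mid b)\sqcap(b\mid c)\equiv(a\mid c)$ whenever $a\le b\le c$. The images of the generators are called basic conditionals and are again written $(a\mid b)$. Let $n$ be the number of atoms of $\mathbf{A}$. For a sequence $\overline\alpha=\langle\alpha_1,\dots,\alpha_{n-1}\rangle$ of pairwise different atoms of $\mathbf{A}$ put $$\omega_{\overline\alpha}=(\alpha_1\mid\top)\sqcap(\alpha_2\mid\neg\alpha_1)\sqcap\dots\sqcap(\alpha_{n-1}\mid\neg\alpha_1\wedge\dots\wedge\neg\alpha_{n-2})$$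 (for $n=1$ this is the top element). Then $\mathcal{C}(\mathbf{A})$ is finite, and $\overline\alpha\mapsto\omega_{\overline\alpha}$ is a bijection from the set of these sequences onto the set of atoms of $\mathcal{C}(\mathbf{A})$. Hence one can define $\mu_P$ on the atoms of $\mathcal{C}(\mathbf{A})$ by $$\mu_P(\omega_{\overline\alpha})=P(\alpha_1)\cdot P(\alpha_2\mid\neg\alpha_1)\cdots P(\alpha_{n-1}\mid\neg\alpha_1\wedge\dots\wedge\neg\alpha_{n-2}),\qquad P(x\mid y)=\frac{P(x\wedge y)}{P(y)}$$ (the empty product $1$ for $n=1$), and on every $t\in\mathcal{C}(\mathbf{A})$ by $$\mu_P(t)=\sum_{\omega \text{ an atom of } \mathcal{C}(\mathbf{A}),\ \omega\le t}\mu_P(\omega).$$ This map $\mu_P$, the canonical extension of $P$, is a positive probability on $\mathcal{C}(\mathbf{A})$ that takes the prescribed values on the atoms, and for all $a\in \mathbf{A}$ and $b\in \mathbf{A}\setminus\{\bot\}$, $$\mu_P\big((a\mid b)\big)=\frac{P(a\wedge b)}{P(b)}.$$ -/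

import Mathlib

namespace CondAlg

universe u

/-! ### Free Boolean algebras -/

/-- Boolean terms over a set `X` of variables. -/
inductive BTerm (X : Type u) : Type u
  | var : X → BTerm X
  | bot : BTerm X
  | top : BTerm X
  | compl : BTerm X → BTerm X
  | inf : BTerm X → BTerm X → BTerm X
  | sup : BTerm X → BTerm X → BTerm X

/-- Two Boolean terms are equivalent when one can be rewritten into the other using only
the laws of Boolean algebras (bounded distributive lattices with complements). -/
inductive BTerm.Equiv {X : Type u} : BTerm X → BTerm X → Prop
  | refl (s) : Equiv s s
  | symm {s t} : Equiv s t → Equiv t s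
  | trans {s t r} : Equiv s t → Equiv t r → Equiv s r
  | compl_congr {s t} : Equiv s t → Equiv (.compl s) (.compl t)
  | inf_congr {s t s' t'} : Equiv s t → Equiv s' t' → Equiv (.inf s s') (.inf t t')
  | sup_congr {s t s' t'} : Equiv s t → Equiv s' t' → Equiv (.sup s s') (.sup t t')
  | inf_comm (s t) : Equiv (.inf s t) (.inf t s)
  | sup_comm (s t) : Equiv (.sup s t) (.sup t s)
  | inf_assoc (s t r) : Equiv (.inf (.inf s t) r) (.inf s (.inf t r))
  | sup_assoc (s t r) : Equiv (.sup (.sup s t) r) (.sup s (.sup t r))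
  | inf_sup_self (s t) : Equiv (.inf s (.sup s t)) s
  | sup_inf_self (s t) : Equiv (.sup s (.inf s t)) s
  | sup_inf_left (s t r) : Equiv (.sup s (.inf t r)) (.inf (.sup s t) (.sup s r))
  | sup_bot (s) : Equiv (.sup s .bot) s
  | inf_top (s) : Equiv (.inf s .top) s
  | inf_compl (s) : Equiv (.inf s (.compl s)) .bot
  | sup_compl (s) : Equiv (.sup s (.compl s)) .top

/-- Equivalence of Boolean terms, as a setoid. -/
def BTerm.setoid (X : Type u) : Setoid (BTerm X) :=
  ⟨BTerm.Equiv, ⟨BTerm.Equiv.refl, BTerm.Equiv.symm, BTerm.Equiv.trans⟩⟩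

/-- The free Boolean algebra generated by `X`. -/
def FreeBA (X : Type u) : Type u := Quotient (BTerm.setoid X)

namespace FreeBA

variable {X : Type u}

/-- The free generators. -/
def var (x : X) : FreeBA X := Quotient.mk (BTerm.setoid X) (BTerm.var x)

/-- The join of classes of terms. -/
def join : FreeBA X → FreeBA X → FreeBA X :=
  Quotient.map₂ BTerm.sup fun _ _ h _ _ h' => BTerm.Equiv.sup_congr h h'

/-- The meet of classes of terms. -/
def meet : FreeBA X → FreeBA X → FreeBA X :=
  Quotient.map₂ BTerm.inf fun _ _ h _ _ h' => BTerm.Equiv.inf_congr h h'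

/-- The lattice with the join and meet above. -/
abbrev latticeStructure : Lattice (FreeBA X) :=
  @Lattice.mk' _ ⟨join⟩ ⟨meet⟩
    (by rintro ⟨a⟩ ⟨b⟩; exact Quotient.sound (BTerm.Equiv.sup_comm a b))
    (by rintro ⟨a⟩ ⟨b⟩ ⟨c⟩; exact Quotient.sound (BTerm.Equiv.sup_assoc a b c))
    (by rintro ⟨a⟩ ⟨b⟩; exact Quotient.sound (BTerm.Equiv.inf_comm a b))
    (by rintro ⟨a⟩ ⟨b⟩ ⟨c⟩; exact Quotient.sound (BTerm.Equiv.inf_assoc a b c))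
    (by rintro ⟨a⟩ ⟨b⟩; exact Quotient.sound (BTerm.Equiv.sup_inf_self a b))
    (by rintro ⟨a⟩ ⟨b⟩; exact Quotient.sound (BTerm.Equiv.inf_sup_self a b))

instance : BooleanAlgebra (FreeBA X) where
  __ := latticeStructure
  sup := join
  inf := meet
  top := Quotient.mk _ BTerm.top
  bot := Quotient.mk _ BTerm.bot
  compl := Quotient.map BTerm.compl fun _ _ h => BTerm.Equiv.compl_congr h
  le_sup_inf := by
    rintro ⟨a⟩ ⟨b⟩ ⟨c⟩
    exact @le_of_eq _ latticeStructure.toPreorder _ _ (Quotient.sound (BTerm.Equiv.sup_inf_left a b c)).symm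
  inf_compl_le_bot := by
    rintro ⟨a⟩
    exact @le_of_eq _ latticeStructure.toPreorder _ _ (Quotient.sound (BTerm.Equiv.inf_compl a))
  top_le_sup_compl := by
    rintro ⟨a⟩
    exact @le_of_eq _ latticeStructure.toPreorder _ _ (Quotient.sound (BTerm.Equiv.sup_compl a)).symm
  le_top := by
    rintro ⟨a⟩
    exact (@inf_eq_left _ latticeStructure.toSemilatticeInf _ _).mp (Quotient.sound (BTerm.Equiv.inf_top a))
  bot_le := by
    rintro ⟨a⟩
    exact (@sup_eq_left _ latticeStructure.toSemilatticeSup _ _).mp (Quotient.sound (BTerm.Equiv.sup_bot a))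

end FreeBA

/-! ### Quotients of Boolean algebras by generated congruences -/

/-- The congruence of the Boolean algebra `B` generated by the relation `r`: the smallest
equivalence relation that contains `r` and is compatible with complement, meet and join. -/
inductive CongGen {B : Type u} [BooleanAlgebra B] (r : B → B → Prop) : B → B → Prop
  | of {a b} : r a b → CongGen r a b
  | refl (a) : CongGen r a a
  | symm {a b} : CongGen r a b → CongGen r b a
  | trans {a b c} : CongGen r a b → CongGen r b c → CongGen r a c
  | compl {a b} : CongGen r a b → CongGen r aᶜ bᶜ
  | inf {a b a' b'} : CongGen r a b → CongGen r a' b' → CongGen r (a ⊓ a') (b ⊓ b')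
  | sup {a b a' b'} : CongGen r a b → CongGen r a' b' → CongGen r (a ⊔ a') (b ⊔ b')

/-- The generated congruence, as a setoid. -/
def CongGen.setoid {B : Type u} [BooleanAlgebra B] (r : B → B → Prop) : Setoid B :=
  ⟨CongGen r, ⟨CongGen.refl, CongGen.symm, CongGen.trans⟩⟩

/-- The quotient of the Boolean algebra `B` by the congruence generated by `r`. -/
def BAQuot {B : Type u} [BooleanAlgebra B] (r : B → B → Prop) : Type u :=
  Quotient (CongGen.setoid r)

namespace BAQuot

variable {B : Type u} [BooleanAlgebra B] {r : B → B → Prop}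

/-- The quotient map. -/
def mk (r : B → B → Prop) (a : B) : BAQuot r := Quotient.mk (CongGen.setoid r) a

/-- The join of classes. -/
def join : BAQuot r → BAQuot r → BAQuot r :=
  Quotient.map₂ (fun a b => a ⊔ b) fun _ _ h _ _ h' => CongGen.sup h h'

/-- The meet of classes. -/
def meet : BAQuot r → BAQuot r → BAQuot r :=
  Quotient.map₂ (fun a b => a ⊓ b) fun _ _ h _ _ h' => CongGen.inf h h'

/-- The lattice with the join and meet above. -/
abbrev latticeStructure : Lattice (BAQuot r) :=
  @Lattice.mk' _ ⟨join⟩ ⟨meet⟩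
    (by rintro ⟨a⟩ ⟨b⟩; exact congrArg (mk r) (sup_comm a b))
    (by rintro ⟨a⟩ ⟨b⟩ ⟨c⟩; exact congrArg (mk r) (sup_assoc a b c))
    (by rintro ⟨a⟩ ⟨b⟩; exact congrArg (mk r) (inf_comm a b))
    (by rintro ⟨a⟩ ⟨b⟩ ⟨c⟩; exact congrArg (mk r) (inf_assoc a b c))
    (by rintro ⟨a⟩ ⟨b⟩; exact congrArg (mk r) (sup_inf_self (a := a) (b := b)))
    (by rintro ⟨a⟩ ⟨b⟩; exact congrArg (mk r) (inf_sup_self (a := a) (b := b)))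

instance : BooleanAlgebra (BAQuot r) where
  __ := latticeStructure
  sup := join
  inf := meet
  top := mk r ⊤
  bot := mk r ⊥
  compl := Quotient.map (fun a => aᶜ) fun _ _ h => CongGen.compl h
  le_sup_inf := by
    rintro ⟨a⟩ ⟨b⟩ ⟨c⟩
    exact @le_of_eq _ latticeStructure.toPreorder _ _ (congrArg (mk r) (sup_inf_left a b c)).symm
  inf_compl_le_bot := by
    rintro ⟨a⟩
    exact @le_of_eq _ latticeStructure.toPreorder _ _ (congrArg (mk r) (inf_compl_self a))
  top_le_sup_compl := by
    rintro ⟨a⟩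
    exact @le_of_eq _ latticeStructure.toPreorder _ _ (congrArg (mk r) (sup_compl_eq_top (x := a))).symm
  le_top := by
    rintro ⟨a⟩
    exact (@inf_eq_left _ latticeStructure.toSemilatticeInf _ _).mp (congrArg (mk r) (inf_top_eq a))
  bot_le := by
    rintro ⟨a⟩
    exact (@sup_eq_left _ latticeStructure.toSemilatticeSup _ _).mp (congrArg (mk r) (sup_bot_eq a))

end BAQuot

/-! ### The Boolean algebra of conditionals -/

section Conditionals

variable (A : Type u) [BooleanAlgebra A]

/-- The formal conditionals `(a | b)` with `a` in `A` and `b` in `A` different from `⊥`. -/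
abbrev FormalCond : Type u := A × {b : A // b ≠ ⊥}

variable {A}

/-- The formal conditional `(a | b)` as a generator of the free Boolean algebra. -/
def fc (a : A) (b : {b : A // b ≠ ⊥}) : FreeBA (FormalCond A) := FreeBA.var (a, b)

variable (A)

/-- The identifications imposed on formal conditionals. -/
inductive CondRel : FreeBA (FormalCond A) → FreeBA (FormalCond A) → Prop
  | self (b : {b : A // b ≠ ⊥}) : CondRel (fc b.1 b) ⊤
  | inf (a₁ a₂ : A) (b : {b : A // b ≠ ⊥}) :
      CondRel (fc a₁ b ⊓ fc a₂ b) (fc (a₁ ⊓ a₂) b)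
  | compl (a : A) (b : {b : A // b ≠ ⊥}) : CondRel (fc a b)ᶜ (fc aᶜ b)
  | restrict (a : A) (b : {b : A // b ≠ ⊥}) : CondRel (fc (a ⊓ b.1) b) (fc a b)
  | chain (a : A) (b c : {b : A // b ≠ ⊥}) (hab : a ≤ b.1) (hbc : b.1 ≤ c.1) :
      CondRel (fc a b ⊓ fc b.1 c) (fc a c)

/-- The Boolean algebra of conditionals of `A`: the free Boolean algebra on the formal
conditionals modulo the congruence generated by `CondRel`. -/
abbrev Cond : Type u := BAQuot (CondRel A)

variable {A}

/-- The basic conditional `(a | b)` as an element of the algebra of conditionals. -/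
def cond (a : A) (b : {b : A // b ≠ ⊥}) : Cond A := BAQuot.mk (CondRel A) (fc a b)

variable (A)

/-- The atoms of `A`. -/
abbrev Atoms : Type u := {α : A // IsAtom α}

/-- Sequences of `k` pairwise different atoms of `A`. -/
abbrev AtomSeq (k : ℕ) : Type u := Fin k ↪ Atoms A

/-- Sequences of `n - 1` pairwise different atoms, where `n` is the number of atoms of `A`. -/
abbrev FullSeq : Type u := AtomSeq A (Nat.card (Atoms A) - 1)

variable {A}

/-- `¬α₁ ∧ … ∧ ¬αᵢ₋₁` for a sequence of atoms (it is `⊤` at the first index). -/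
def before {k : ℕ} (s : AtomSeq A k) (i : Fin k) : A :=
  (Finset.Iio i).inf fun j => ((s j : A))ᶜ

theorem le_before {k : ℕ} (s : AtomSeq A k) (i : Fin k) : (s i : A) ≤ before s i := by
  refine Finset.le_inf fun j hj => ?_
  refine Disjoint.le_compl_right ?_
  refine (s i).2.disjoint_of_ne (s j).2 fun h => ?_
  have hij : i = j := s.injective (Subtype.ext h)
  exact absurd (Finset.mem_Iio.mp hj) (by simp [hij])

theorem before_ne_bot {k : ℕ} (s : AtomSeq A k) (i : Fin k) : before s i ≠ ⊥ :=
  fun h => (s i).2.1 (le_bot_iff.mp (h ▸ le_before s i))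

/-- The compound conditional
`(α₁ | ⊤) ⊓ (α₂ | ¬α₁) ⊓ … ⊓ (αₖ | ¬α₁ ∧ … ∧ ¬αₖ₋₁)`. -/
def omega {k : ℕ} (s : AtomSeq A k) : Cond A :=
  Finset.univ.inf fun i => cond (s i : A) ⟨before s i, before_ne_bot s i⟩

end Conditionals

/-! ### Probabilities and the canonical extension -/

/-- A positive (finitely additive) probability on a Boolean algebra. -/
structure IsPositiveProb {B : Type u} [BooleanAlgebra B] (P : B → ℝ) : Prop where
  mem_Icc : ∀ a, P a ∈ Set.Icc (0 : ℝ) 1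
  map_top : P ⊤ = 1
  map_sup : ∀ a b, a ⊓ b = ⊥ → P (a ⊔ b) = P a + P b
  pos : ∀ a, a ≠ ⊥ → 0 < P a

section Extension

variable {A : Type u} [BooleanAlgebra A]

/-- The conditional probability `P(a | b) = P(a ∧ b) / P(b)`. -/
noncomputable def condProb (P : A → ℝ) (a b : A) : ℝ := P (a ⊓ b) / P b

/-- The product `P(α₁ | ⊤) · P(α₂ | ¬α₁) · … · P(αₖ | ¬α₁ ∧ … ∧ ¬αₖ₋₁)`; its first factor
is `P(α₁)` when `P ⊤ = 1`. -/
noncomputable def seqWeight (P : A → ℝ) {k : ℕ} (s : AtomSeq A k) : ℝ :=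
  ∏ i, condProb P (s i : A) (before s i)

/-- The distribution on the atoms of the algebra of conditionals that assigns to `omega s`
the weight of the sequence `s` (and `0` to elements that are not of this form). -/
noncomputable def atomWeight (P : A → ℝ) : Cond A → ℝ :=
  Function.extend (fun s : FullSeq A => omega s) (fun s => seqWeight P s) 0

/-- The canonical extension of `P`: the sum of the weights of the atoms below `t`. -/
noncomputable def canonicalExtension (P : A → ℝ) (t : Cond A) : ℝ :=
  ∑ᶠ ω ∈ {ω : Cond A | IsAtom ω ∧ ω ≤ t}, atomWeight P ω

end Extension

end CondAlg

namespace CondAlg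

/-! ### Evaluation of conditionals under a valuation of the generators -/

section Eval

universe u
variable {X : Type u}

/-! A sequence of `n - 1` distinct atoms ranks all the atoms, the missing one coming last. A ranking
decides every conditional: `(a | b)` holds when the first atom below `b` lies below `a`. This
valuation respects the defining relations (`rankVal_condRel`) and makes `omega s` true for its own
sequence, so `omega s ≠ ⊥`. Conversely `omega s` lies below each basic conditional or its complement
(`omega_le_cond_or`), hence decides every element and is an atom. There are no other atoms: the
conditionals `(α | rest s)`, for atoms `α` below `rest s`, join to `⊤`, so an element disjoint from
all extensions of a prefix is disjoint from the prefix, down to the empty one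
(`eq_bot_of_inf_omega_eq_bot`).

For the measure, the same splitting by the next atom is a law of total probability
(`IsAdditive.eq_sum_cond`). Descending induction on the length of a prefix `s` gives the measure of
`omega s`, and then, for `b ≤ rest s`, that of `(a | b) ⊓ omega s` as the weight of `s` times `P (a
⊓ b) / P b` (`canonicalExtension_cond_inf_omega`). The empty prefix yields total mass `1` and the
formula for `(a | b)`. -/

/-- The truth value of a Boolean term under a valuation of the variables. -/
def BTerm.eval (v : X → Prop) : BTerm X → Prop
  | var x => v x
  | bot => False
  | top => True
  | compl s => ¬ s.eval v
  | inf s t => s.eval v ∧ t.eval v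
  | sup s t => s.eval v ∨ t.eval v

theorem BTerm.Equiv.eval_eq (v : X → Prop) {s t : BTerm X} (h : BTerm.Equiv s t) :
    s.eval v = t.eval v := by
  induction h <;> simp only [BTerm.eval, eq_iff_iff] at * <;> tauto

/-- The truth value of an element of the free Boolean algebra under a valuation. -/
def FreeBA.eval (v : X → Prop) : FreeBA X → Prop :=
  Quotient.lift (BTerm.eval v) fun _ _ h => BTerm.Equiv.eval_eq v h

theorem FreeBA.eval_inf (v : X → Prop) (x y : FreeBA X) :
    FreeBA.eval v (x ⊓ y) = (FreeBA.eval v x ∧ FreeBA.eval v y) := by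
  rcases x with ⟨x⟩; rcases y with ⟨y⟩; rfl

theorem FreeBA.eval_sup (v : X → Prop) (x y : FreeBA X) :
    FreeBA.eval v (x ⊔ y) = (FreeBA.eval v x ∨ FreeBA.eval v y) := by
  rcases x with ⟨x⟩; rcases y with ⟨y⟩; rfl

theorem FreeBA.eval_compl (v : X → Prop) (x : FreeBA X) :
    FreeBA.eval v xᶜ = ¬ FreeBA.eval v x := by
  rcases x with ⟨x⟩; rfl

theorem FreeBA.induction {p : FreeBA X → Prop} (var : ∀ x, p (FreeBA.var x)) (top : p ⊤)
    (compl : ∀ x, p x → p xᶜ) (inf : ∀ x y, p x → p y → p (x ⊓ y)) (x : FreeBA X) : p x := by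
  rcases x with ⟨x⟩
  induction x with
  | var x => exact var x
  | bot =>
    have h := compl ⊤ top
    rw [compl_top] at h
    exact h
  | top => exact top
  | compl s hs => exact compl _ hs
  | inf s t hs ht => exact inf _ _ hs ht
  | sup s t hs ht =>
    have key : ∀ x y : FreeBA X, p x → p y → p (x ⊔ y) := fun x y hx hy => by
      have h := compl _ (inf _ _ (compl _ hx) (compl _ hy))
      rwa [compl_inf, compl_compl, compl_compl] at h
    exact key _ _ hs ht

variable {r : FreeBA X → FreeBA X → Prop}

theorem CongGen.eval_eq {v : X → Prop} (hv : ∀ x y, r x y → FreeBA.eval v x = FreeBA.eval v y)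
    {x y : FreeBA X} (h : CongGen r x y) : FreeBA.eval v x = FreeBA.eval v y := by
  induction h with
  | of h => exact hv _ _ h
  | refl => rfl
  | symm _ ih => exact ih.symm
  | trans _ _ ih ih' => exact ih.trans ih'
  | compl _ ih => rw [FreeBA.eval_compl, FreeBA.eval_compl, ih]
  | inf _ _ ih ih' => rw [FreeBA.eval_inf, FreeBA.eval_inf, ih, ih']
  | sup _ _ ih ih' => rw [FreeBA.eval_sup, FreeBA.eval_sup, ih, ih']

/-- The truth value of an element of a presented Boolean algebra under a valuation that
respects the relations. -/
def BAQuot.eval (v : X → Prop) (hv : ∀ x y, r x y → FreeBA.eval v x = FreeBA.eval v y) :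
    BAQuot r → Prop :=
  Quotient.lift (FreeBA.eval v) fun _ _ h => CongGen.eval_eq hv h

theorem BAQuot.eval_inf (v : X → Prop)
    (hv : ∀ x y, r x y → FreeBA.eval v x = FreeBA.eval v y) (x y : BAQuot r) :
    BAQuot.eval v hv (x ⊓ y) = (BAQuot.eval v hv x ∧ BAQuot.eval v hv y) := by
  rcases x with ⟨x⟩; rcases y with ⟨y⟩; exact FreeBA.eval_inf v x y

end Eval

/-! ### Basic conditionals -/

section Basic

variable {A : Type*} [BooleanAlgebra A]

theorem cond_self (b : {b : A // b ≠ ⊥}) : cond b.1 b = ⊤ :=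
  Quotient.sound (CongGen.of (CondRel.self b))

theorem cond_inf (a₁ a₂ : A) (b : {b : A // b ≠ ⊥}) :
    cond (a₁ ⊓ a₂) b = cond a₁ b ⊓ cond a₂ b :=
  (Quotient.sound (CongGen.of (CondRel.inf a₁ a₂ b))).symm

theorem cond_compl (a : A) (b : {b : A // b ≠ ⊥}) : cond aᶜ b = (cond a b)ᶜ :=
  (Quotient.sound (CongGen.of (CondRel.compl a b))).symm

theorem cond_restrict (a : A) (b : {b : A // b ≠ ⊥}) : cond (a ⊓ b.1) b = cond a b :=
  Quotient.sound (CongGen.of (CondRel.restrict a b))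

theorem cond_chain {a : A} {b c : {b : A // b ≠ ⊥}} (hab : a ≤ b.1) (hbc : b.1 ≤ c.1) :
    cond a b ⊓ cond b.1 c = cond a c :=
  Quotient.sound (CongGen.of (CondRel.chain a b c hab hbc))

theorem cond_sup (a₁ a₂ : A) (b : {b : A // b ≠ ⊥}) :
    cond (a₁ ⊔ a₂) b = cond a₁ b ⊔ cond a₂ b := by
  have h : a₁ ⊔ a₂ = (a₁ᶜ ⊓ a₂ᶜ)ᶜ := by simp
  rw [h, cond_compl, cond_inf, cond_compl, cond_compl]
  simp

theorem cond_bot (b : {b : A // b ≠ ⊥}) : cond ⊥ b = ⊥ := by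
  rw [← inf_compl_self b.1, cond_inf, cond_compl, inf_compl_self]

theorem cond_mono {a₁ a₂ : A} (h : a₁ ≤ a₂) (b : {b : A // b ≠ ⊥}) : cond a₁ b ≤ cond a₂ b := by
  rw [← inf_eq_left, ← cond_inf, inf_eq_left.mpr h]

theorem cond_eq_top {a : A} {b : {b : A // b ≠ ⊥}} (h : b.1 ≤ a) : cond a b = ⊤ := by
  rw [← cond_restrict, inf_eq_right.mpr h, cond_self]

theorem cond_eq_bot {a : A} {b : {b : A // b ≠ ⊥}} (h : a ⊓ b.1 = ⊥) : cond a b = ⊥ := by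
  rw [← cond_restrict, h, cond_bot]

/-- The form in which the chain relation is used: a consequent secured under a wide condition stays
secured under every narrower condition that contains it. -/
theorem cond_antitone {a : A} {b c : {b : A // b ≠ ⊥}} (hab : a ≤ b.1) (hbc : b.1 ≤ c.1) :
    cond a c ≤ cond a b := by
  rw [← cond_chain hab hbc]
  exact inf_le_left

end Basic

/-! ### Sequences of atoms -/

section Sequences

variable {A : Type*} [BooleanAlgebra A]

/-- The meet of the complements of all the members of a sequence of atoms. -/
def rest {k : ℕ} (s : AtomSeq A k) : A := Finset.univ.inf fun j => ((s j : A))ᶜ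

theorem atom_le_compl_iff {α β : A} (hα : IsAtom α) (hβ : IsAtom β) : α ≤ βᶜ ↔ α ≠ β := by
  rw [le_compl_iff_disjoint_right]
  refine ⟨fun h e => hα.1 ?_, hα.disjoint_of_ne hβ⟩
  subst e
  exact disjoint_self.mp h

theorem atom_le_sup_iff {α : A} (hα : IsAtom α) (x y : A) : α ≤ x ⊔ y ↔ α ≤ x ∨ α ≤ y := by
  refine ⟨fun h => ?_, fun h => h.elim le_sup_of_le_left le_sup_of_le_right⟩
  by_contra! hn
  have h₁ := hα.not_le_iff_disjoint.mp hn.1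
  have h₂ := hα.not_le_iff_disjoint.mp hn.2
  exact hα.not_le_iff_disjoint.mpr (disjoint_sup_right.mpr ⟨h₁, h₂⟩) h

theorem atom_le_compl_iff_not_le {α : A} (hα : IsAtom α) (x : A) : α ≤ xᶜ ↔ ¬ α ≤ x := by
  rw [le_compl_iff_disjoint_right, hα.not_le_iff_disjoint]

theorem le_before_iff {k : ℕ} (s : AtomSeq A k) (i : Fin k) (x : A) :
    x ≤ before s i ↔ ∀ j < i, x ≤ (s j : A)ᶜ := by
  simp [before, Finset.le_inf_iff]

theorem le_rest_iff {k : ℕ} (s : AtomSeq A k) (x : A) : x ≤ rest s ↔ ∀ j, x ≤ (s j : A)ᶜ := by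
  simp [rest, Finset.le_inf_iff]

theorem atom_le_rest_iff {k : ℕ} (s : AtomSeq A k) (α : Atoms A) :
    (α : A) ≤ rest s ↔ ∀ j, s j ≠ α := by
  rw [le_rest_iff]
  refine forall_congr' fun j => ?_
  rw [atom_le_compl_iff α.2 (s j).2, ne_comm, Ne, Ne, Subtype.ext_iff]

/-- Append an atom to a sequence of atoms. -/
def snoc {k : ℕ} (s : AtomSeq A k) (α : Atoms A) (h : (α : A) ≤ rest s) : AtomSeq A (k + 1) :=
  ⟨Fin.snoc s α, Fin.snoc_injective_iff.mpr
    ⟨s.injective, by rintro ⟨j, hj⟩; exact (atom_le_rest_iff s α).mp h j hj⟩⟩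

@[simp] theorem snoc_castSucc {k : ℕ} (s : AtomSeq A k) (α : Atoms A) (h : (α : A) ≤ rest s)
    (i : Fin k) : snoc s α h i.castSucc = s i := by
  simp [snoc]

@[simp] theorem snoc_last {k : ℕ} (s : AtomSeq A k) (α : Atoms A) (h : (α : A) ≤ rest s) :
    snoc s α h (Fin.last k) = α := by
  simp [snoc]

theorem before_snoc_castSucc {k : ℕ} (s : AtomSeq A k) (α : Atoms A) (h : (α : A) ≤ rest s)
    (i : Fin k) : before (snoc s α h) i.castSucc = before s i := by
  refine eq_of_forall_le_iff fun x => ?_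
  rw [le_before_iff, le_before_iff, Fin.forall_fin_succ']
  simp [Fin.castSucc_lt_castSucc_iff, (Fin.castSucc_lt_last i).not_gt]

theorem before_snoc_last {k : ℕ} (s : AtomSeq A k) (α : Atoms A) (h : (α : A) ≤ rest s) :
    before (snoc s α h) (Fin.last k) = rest s := by
  refine eq_of_forall_le_iff fun x => ?_
  rw [le_before_iff, le_rest_iff, Fin.forall_fin_succ']
  simp [Fin.castSucc_lt_last]

theorem rest_snoc {k : ℕ} (s : AtomSeq A k) (α : Atoms A) (h : (α : A) ≤ rest s) :
    rest (snoc s α h) = rest s ⊓ (α : A)ᶜ := by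
  refine eq_of_forall_le_iff fun x => ?_
  rw [le_rest_iff, le_inf_iff, le_rest_iff, Fin.forall_fin_succ']
  simp

theorem le_omega_iff {k : ℕ} (s : AtomSeq A k) (x : Cond A) :
    x ≤ omega s ↔ ∀ i, x ≤ cond (s i : A) ⟨before s i, before_ne_bot s i⟩ := by
  simp [omega, Finset.le_inf_iff]

theorem omega_le {k : ℕ} (s : AtomSeq A k) (i : Fin k) :
    omega s ≤ cond (s i : A) ⟨before s i, before_ne_bot s i⟩ :=
  (le_omega_iff s _).mp le_rfl i

theorem omega_snoc {k : ℕ} (s : AtomSeq A k) (α : Atoms A) (h : (α : A) ≤ rest s)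
    (hs : rest s ≠ ⊥) : omega (snoc s α h) = omega s ⊓ cond (α : A) ⟨rest s, hs⟩ := by
  refine eq_of_forall_le_iff fun x => ?_
  rw [le_omega_iff, le_inf_iff, le_omega_iff, Fin.forall_fin_succ']
  simp only [snoc_castSucc, snoc_last, before_snoc_castSucc, before_snoc_last]

theorem omega_zero (s : AtomSeq A 0) : omega s = ⊤ := by
  simp [omega]

theorem rest_zero (s : AtomSeq A 0) : rest s = ⊤ := by
  simp [rest]

theorem seqWeight_snoc (P : A → ℝ) {k : ℕ} (s : AtomSeq A k) (α : Atoms A)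
    (h : (α : A) ≤ rest s) :
    seqWeight P (snoc s α h) = seqWeight P s * (P α / P (rest s)) := by
  simp only [seqWeight, Fin.prod_univ_castSucc, snoc_castSucc, snoc_last, before_snoc_castSucc,
    before_snoc_last, condProb, inf_eq_left.mpr h]

theorem rest_ne_bot {k : ℕ} (s : AtomSeq A k) (hk : k < Nat.card (Atoms A)) : rest s ≠ ⊥ := by
  intro h
  have hsurj : Function.Surjective s := by
    intro α
    by_contra! hα
    have := (atom_le_rest_iff s α).mpr hα
    rw [h] at this
    exact α.2.1 (le_bot_iff.mp this)
  have := Nat.card_le_card_of_surjective s hsurj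
  simp at this
  omega

variable [Finite A]

theorem length_le {k : ℕ} (s : AtomSeq A k) : k ≤ Nat.card (Atoms A) := by
  simpa using Nat.card_le_card_of_injective s s.injective

theorem eq_of_le_of_atoms {x y : A} (h : ∀ α : Atoms A, (α : A) ≤ x → (α : A) ≤ y) : x ≤ y :=
  BooleanAlgebra.le_iff_atom_le_imp.mpr fun α hα hx => h ⟨α, hα⟩ hx

theorem exists_atom_le {x : A} (h : x ≠ ⊥) : ∃ α : Atoms A, (α : A) ≤ x := by
  obtain h' | ⟨α, hα, hx⟩ := eq_bot_or_exists_atom_le x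
  · exact absurd h' h
  · exact ⟨⟨α, hα⟩, hx⟩

/-- At most one atom is missing from a full sequence. -/
theorem eq_of_le_rest (s : FullSeq A) {α β : Atoms A} (hα : (α : A) ≤ rest s)
    (hβ : (β : A) ≤ rest s) : α = β := by
  by_contra hne
  have h : (β : A) ≤ rest (snoc s α hα) := by
    rw [rest_snoc]
    exact le_inf hβ ((atom_le_compl_iff β.2 α.2).mpr fun e => hne (Subtype.ext e.symm))
  -- Two missing atoms would give `(n - 1) + 2 > n` distinct atoms, also when the subtraction
  -- truncates.
  have := length_le (snoc (snoc s α hα) β h)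
  omega

/-- A nonzero element that avoids a full sequence is the last atom. -/
theorem isAtom_of_le_rest (s : FullSeq A) {b : A} (hb : b ≠ ⊥) (h : b ≤ rest s) :
    IsAtom b := by
  obtain ⟨α, hα⟩ := exists_atom_le hb
  have : b = α := by
    refine le_antisymm (eq_of_le_of_atoms fun β hβ => ?_) hα
    rw [eq_of_le_rest s (hβ.trans h) (hα.trans h)]
  rw [this]
  exact α.2

end Sequences

/-! ### Atoms of the algebra of conditionals -/

section AtomsOfCond

variable {A : Type*} [BooleanAlgebra A]

/-- The valuation of the formal conditionals determined by a ranking of the atoms: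
`(a | b)` is true when the first atom below `b` is below `a`. -/
def rankVal (r : Atoms A → ℕ) (x : FormalCond A) : Prop :=
  ∃ α : Atoms A, (α : A) ≤ x.1 ∧ (α : A) ≤ x.2.1 ∧ ∀ β : Atoms A, (β : A) ≤ x.2.1 → r α ≤ r β

/-- Injectivity of the ranking makes the first atom below `b` unique, so any known first atom can
serve as the witness. -/
theorem rankVal_iff {r : Atoms A → ℕ} (hr : Function.Injective r) {b : {b : A // b ≠ ⊥}}
    {α : Atoms A} (hα : (α : A) ≤ b.1) (hmin : ∀ β : Atoms A, (β : A) ≤ b.1 → r α ≤ r β) (a : A) :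
    rankVal r (a, b) = ((α : A) ≤ a) := by
  refine propext ⟨?_, fun h => ⟨α, h, hα, hmin⟩⟩
  rintro ⟨β, hβa, hβb, hβ⟩
  rwa [hr (le_antisymm (hmin β hβb) (hβ α hα))]

open Classical in
/-- The position of an atom in a full sequence; the missing atom comes last. -/
noncomputable def rank (s : FullSeq A) (α : Atoms A) : ℕ :=
  if h : ∃ i, s i = α then h.choose else Nat.card (Atoms A) - 1

theorem rank_apply (s : FullSeq A) (i) : rank s (s i) = i := by
  have h : ∃ j, s j = s i := ⟨i, rfl⟩
  rw [rank, dif_pos h, s.injective h.choose_spec]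

theorem rank_of_le_rest (s : FullSeq A) {α : Atoms A} (h : (α : A) ≤ rest s) :
    rank s α = Nat.card (Atoms A) - 1 := by
  rw [rank, dif_neg]
  rw [atom_le_rest_iff] at h
  exact not_exists.mpr h

theorem mem_range_or_le_rest {k : ℕ} (s : AtomSeq A k) (α : Atoms A) :
    (∃ i, s i = α) ∨ (α : A) ≤ rest s := by
  rw [atom_le_rest_iff, ← not_exists]
  exact em _

variable [Finite A]

theorem exists_first (r : Atoms A → ℕ) {b : A} (hb : b ≠ ⊥) :
    ∃ α : Atoms A, (α : A) ≤ b ∧ ∀ β : Atoms A, (β : A) ≤ b → r α ≤ r β := by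
  obtain ⟨α, hα, hmin⟩ := (measure r).wf.has_min {α : Atoms A | (α : A) ≤ b} (exists_atom_le hb)
  exact ⟨α, hα, fun β hβ => not_lt.mp (hmin β hβ)⟩

theorem rankVal_condRel {r : Atoms A → ℕ} (hr : Function.Injective r)
    (x y : FreeBA (FormalCond A)) (h : CondRel A x y) :
    FreeBA.eval (rankVal r) x = FreeBA.eval (rankVal r) y := by
  have hfc : ∀ a b, FreeBA.eval (rankVal r) (fc a b) = rankVal r (a, b) := fun _ _ => rfl
  cases h with
  | self b =>
    obtain ⟨α, hα, hmin⟩ := exists_first r b.2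
    rw [hfc, rankVal_iff hr hα hmin]
    exact eq_true hα
  | inf a₁ a₂ b =>
    obtain ⟨α, hα, hmin⟩ := exists_first r b.2
    rw [FreeBA.eval_inf, hfc, hfc, hfc, rankVal_iff hr hα hmin, rankVal_iff hr hα hmin,
      rankVal_iff hr hα hmin, le_inf_iff]
  | compl a b =>
    obtain ⟨α, hα, hmin⟩ := exists_first r b.2
    rw [FreeBA.eval_compl, hfc, hfc, rankVal_iff hr hα hmin, rankVal_iff hr hα hmin,
      atom_le_compl_iff_not_le α.2]
  | restrict a b =>
    obtain ⟨α, hα, hmin⟩ := exists_first r b.2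
    rw [hfc, hfc, rankVal_iff hr hα hmin, rankVal_iff hr hα hmin, le_inf_iff]
    exact propext (and_iff_left hα)
  | chain a b c hab hbc =>
    obtain ⟨α, hα, hmin⟩ := exists_first r b.2
    obtain ⟨β, hβ, hmin'⟩ := exists_first r c.2
    rw [FreeBA.eval_inf, hfc, hfc, hfc, rankVal_iff hr hα hmin, rankVal_iff hr hβ hmin',
      rankVal_iff hr hβ hmin']
    -- If the first atom below `c` already lies below `b ≤ c`, it is also the first atom below `b`.
    have key : (β : A) ≤ b.1 → α = β := fun h =>
      hr (le_antisymm (hmin β h) (hmin' α (hα.trans hbc)))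
    refine propext ⟨fun h => key h.2 ▸ h.1, fun h => ?_⟩
    have hβb := h.trans hab
    exact ⟨(key hβb).symm ▸ h, hβb⟩

theorem rank_injective (s : FullSeq A) : Function.Injective (rank s) := by
  intro α β h
  obtain ⟨i, rfl⟩ | hα := mem_range_or_le_rest s α <;>
    obtain ⟨j, rfl⟩ | hβ := mem_range_or_le_rest s β
  · rw [rank_apply, rank_apply] at h
    rw [Fin.ext h]
  · rw [rank_apply, rank_of_le_rest s hβ] at h
    exact absurd h i.2.ne
  · rw [rank_apply, rank_of_le_rest s hα] at h
    exact absurd h j.2.ne'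
  · exact eq_of_le_rest s hα hβ

theorem omega_ne_bot (s : FullSeq A) : omega s ≠ ⊥ := by
  have hv := rankVal_condRel (rank_injective s)
  have h : BAQuot.eval (rankVal (rank s)) hv (omega s) := by
    refine Finset.inf_induction (p := BAQuot.eval (rankVal (rank s)) hv) trivial
      (fun x hx y hy => (BAQuot.eval_inf _ hv x y).mpr ⟨hx, hy⟩) fun i _ => ?_
    -- Earlier members of `s` are excluded by `before s i`, so `s i` is the first atom below it.
    refine ⟨s i, le_rfl, le_before s i, fun β hβ => ?_⟩
    rw [rank_apply]
    obtain ⟨j, rfl⟩ | hr := mem_range_or_le_rest s β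
    · rw [rank_apply]
      by_contra! hj
      exact (atom_le_compl_iff (s j).2 (s j).2).mp ((le_before_iff s i _).mp hβ j hj) rfl
    · rw [rank_of_le_rest s hr]
      exact i.2.le
  intro e
  rw [e] at h
  exact h

/-- At the first place where two sequences differ, their conditionals share the condition and have
disjoint consequents, so a common value would be `⊥`. -/
theorem omega_injective : Function.Injective fun s : FullSeq A => omega s := by
  intro s t hst
  have hst : omega s = omega t := hst
  refine DFunLike.ext _ _ fun i => ?_
  induction i using WellFoundedLT.induction with
  | ind i ih =>
    have hb : before s i = before t i := eq_of_forall_le_iff fun x => by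
      rw [le_before_iff, le_before_iff]
      exact forall₂_congr fun j hj => by rw [ih j hj]
    by_contra hne
    have h₁ := omega_le s i
    have h₂ := omega_le t i
    have e : (⟨before t i, before_ne_bot t i⟩ : {b : A // b ≠ ⊥}) =
      ⟨before s i, before_ne_bot s i⟩ := Subtype.ext hb.symm
    rw [e, ← hst] at h₂
    have h := le_inf h₁ h₂
    have hd : (s i : A) ⊓ t i = ⊥ :=
      ((s i).2.disjoint_of_ne (t i).2 fun e => hne (Subtype.ext e)).eq_bot
    rw [← cond_inf, hd, cond_bot] at h
    exact omega_ne_bot s (le_bot_iff.mp h)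

/-- The first member of `s` below `b` settles the matter: `b` lies below the condition attached to
that member, so `omega s` forces this atom given `b`. -/
theorem omega_le_cond_or (s : FullSeq A) (a : A) (b : {b : A // b ≠ ⊥}) :
    omega s ≤ cond a b ∨ omega s ≤ (cond a b)ᶜ := by
  by_cases hb : ∃ i, (s i : A) ≤ b.1
  · obtain ⟨i, hi, hmin⟩ := (wellFounded_lt (α := Fin _)).has_min {i | (s i : A) ≤ b.1} hb
    have hbi : b.1 ≤ before s i := by
      rw [le_before_iff]
      intro j hj
      rw [le_compl_comm, atom_le_compl_iff_not_le (s j).2]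
      exact fun h => hmin j h hj
    have h : omega s ≤ cond (s i : A) b :=
      (omega_le s i).trans (cond_antitone (c := ⟨before s i, before_ne_bot s i⟩) hi hbi)
    rw [← cond_compl]
    by_cases ha : (s i : A) ≤ a
    · exact .inl (h.trans (cond_mono ha b))
    · exact .inr (h.trans (cond_mono ((atom_le_compl_iff_not_le (s i).2 a).mpr ha) b))
  -- No member of `s` is below `b`, so `b` is the one missing atom, and `(a | b)` is `⊤` or `⊥`
  -- outright.
  · push Not at hb
    have hr : b.1 ≤ rest s := by
      rw [le_rest_iff]
      intro j
      rw [le_compl_comm, atom_le_compl_iff_not_le (s j).2]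
      exact hb j
    rw [← cond_compl]
    by_cases ha : b.1 ≤ a
    · exact .inl (le_top.trans (cond_eq_top ha).ge)
    · exact .inr (le_top.trans
        (cond_eq_top ((atom_le_compl_iff_not_le (isAtom_of_le_rest s b.2 hr) a).mpr ha)).ge)

theorem omega_le_or (s : FullSeq A) (t : Cond A) : omega s ≤ t ∨ omega s ≤ tᶜ := by
  obtain ⟨t, rfl⟩ : ∃ t', BAQuot.mk (CondRel A) t' = t := Quotient.exists_rep t
  induction t using FreeBA.induction with
  | var x => exact omega_le_cond_or s x.1 x.2
  | top => exact .inl le_top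
  | compl x hx =>
    change omega s ≤ (BAQuot.mk (CondRel A) x)ᶜ ∨ omega s ≤ (BAQuot.mk (CondRel A) x)ᶜᶜ
    rw [compl_compl]
    exact hx.symm
  | inf x y hx hy =>
    change omega s ≤ BAQuot.mk (CondRel A) x ⊓ BAQuot.mk (CondRel A) y ∨
      omega s ≤ (BAQuot.mk (CondRel A) x ⊓ BAQuot.mk (CondRel A) y)ᶜ
    rw [compl_inf]
    rcases hx with hx | hx
    · rcases hy with hy | hy
      · exact .inl (le_inf hx hy)
      · exact .inr (le_sup_of_le_right hy)
    · exact .inr (le_sup_of_le_left hx)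

theorem isAtom_omega (s : FullSeq A) : IsAtom (omega s) := by
  refine ⟨omega_ne_bot s, fun t ht => ?_⟩
  rcases omega_le_or s t with h | h
  · exact absurd ht h.not_gt
  · exact le_bot_iff.mp ((le_inf le_rfl (ht.le.trans h)).trans (inf_compl_self t).le)

theorem induction_atoms {p : A → Prop} (bot : p ⊥)
    (sup : ∀ (α : Atoms A) (a : A), ¬ (α : A) ≤ a → p a → p (a ⊔ α)) (a : A) : p a := by
  induction h : Nat.card {α : Atoms A // (α : A) ≤ a} using Nat.strong_induction_on generalizing a with
  | _ n ih =>
    by_cases ha : a = ⊥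
    · exact ha ▸ bot
    · obtain ⟨α, hα⟩ := exists_atom_le ha
      have hn : ¬ (α : A) ≤ a ⊓ (α : A)ᶜ := fun h =>
        (atom_le_compl_iff α.2 α.2).mp (h.trans inf_le_right) rfl
      have e : (a ⊓ (α : A)ᶜ) ⊔ α = a := by
        rw [sup_inf_right, compl_sup_eq_top, inf_top_eq, sup_eq_left.mpr hα]
      rw [← e]
      refine sup α _ hn (ih _ ?_ _ rfl)
      rw [← h]
      have hsub : {β : Atoms A | (β : A) ≤ a ⊓ (α : A)ᶜ} ⊂ {β : Atoms A | (β : A) ≤ a} :=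
        ⟨fun β hβ => le_trans (show (β : A) ≤ _ from hβ) inf_le_left, fun h => hn (h hα)⟩
      exact Set.ncard_lt_ncard hsub (Set.toFinite _)

theorem eq_bot_of_inf_cond_eq_bot {x : Cond A} {b : {b : A // b ≠ ⊥}}
    (h : ∀ α : Atoms A, (α : A) ≤ b.1 → x ⊓ cond (α : A) b = ⊥) : x = ⊥ := by
  have key : ∀ a : A, x ⊓ cond a b = ⊥ := by
    refine induction_atoms (by rw [cond_bot, inf_bot_eq]) fun α a _ ih => ?_
    rw [cond_sup, inf_sup_left, ih, bot_sup_eq]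
    by_cases hα : (α : A) ≤ b.1
    · exact h α hα
    · rw [cond_eq_bot (α.2.not_le_iff_disjoint.mp hα).eq_bot, inf_bot_eq]
  have := key b.1
  rwa [cond_self, inf_top_eq] at this

theorem eq_bot_of_inf_omega_eq_bot {x : Cond A} (h : ∀ s : FullSeq A, x ⊓ omega s = ⊥) :
    x = ⊥ := by
  -- `d` counts the atoms still to be appended.
  have key : ∀ d k, k + d = Nat.card (Atoms A) - 1 → ∀ s : AtomSeq A k, x ⊓ omega s = ⊥ := by
    intro d
    induction d with
    | zero =>
      intro k hk s
      obtain rfl : k = _ := hk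
      exact h s
    | succ d ih =>
      intro k hk s
      have hs : rest s ≠ ⊥ := rest_ne_bot s (by omega)
      refine eq_bot_of_inf_cond_eq_bot (b := ⟨rest s, hs⟩) fun α hα => ?_
      rw [inf_assoc, ← omega_snoc s α hα hs]
      exact ih _ (by omega) _
  have := key _ 0 (Nat.zero_add _) ⟨Fin.elim0, fun i => i.elim0⟩
  rwa [omega_zero, inf_top_eq] at this

theorem exists_omega_le {x : Cond A} (h : x ≠ ⊥) : ∃ s : FullSeq A, omega s ≤ x := by
  by_contra! hx
  refine h (eq_bot_of_inf_omega_eq_bot fun s => ?_)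
  rw [inf_comm]
  exact ((isAtom_omega s).not_le_iff_disjoint.mp (hx s)).eq_bot

theorem bijOn_omega : Set.BijOn (fun s : FullSeq A => omega s) Set.univ
    {ω : Cond A | IsAtom ω} := by
  refine ⟨fun s _ => isAtom_omega s, omega_injective.injOn, fun ω hω => ?_⟩
  obtain ⟨s, hs⟩ := exists_omega_le hω.1
  exact ⟨s, trivial, (hω.le_iff_eq (omega_ne_bot s)).mp hs⟩

theorem le_of_omega_le {x y : Cond A} (h : ∀ s : FullSeq A, omega s ≤ x → omega s ≤ y) :
    x ≤ y := by
  rw [← sdiff_eq_bot_iff]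
  by_contra hne
  obtain ⟨s, hs⟩ := exists_omega_le hne
  rw [sdiff_eq] at hs
  exact (atom_le_compl_iff_not_le (isAtom_omega s) y).mp (hs.trans inf_le_right)
    (h s (hs.trans inf_le_left))

/-- An element is determined by the set of sequences `s` with `omega s` below it, and there are
finitely many sequences. -/
theorem finite_cond : Finite (Cond A) := by
  refine Finite.of_injective (fun x : Cond A => {s : FullSeq A | omega s ≤ x}) fun x y h => ?_
  have h' : ∀ s : FullSeq A, omega s ≤ x ↔ omega s ≤ y := fun s => Set.ext_iff.mp h s
  exact le_antisymm (le_of_omega_le fun s => (h' s).mp) (le_of_omega_le fun s => (h' s).mpr)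

end AtomsOfCond

/-! ### The canonical extension -/

section Additive

variable {B : Type*} [BooleanAlgebra B]

/-- Finite additivity of a real function on a Boolean algebra. -/
def IsAdditive (f : B → ℝ) : Prop := ∀ a b, a ⊓ b = ⊥ → f (a ⊔ b) = f a + f b

theorem IsAdditive.map_bot {f : B → ℝ} (hf : IsAdditive f) : f ⊥ = 0 := by
  have := hf ⊥ ⊥ (inf_bot_eq ⊥)
  simpa using this

theorem IsAdditive.comp_inf {f : B → ℝ} (hf : IsAdditive f) (x : B) :
    IsAdditive fun a => f (a ⊓ x) := by
  intro a b h
  change f ((a ⊔ b) ⊓ x) = _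
  rw [inf_sup_right, hf]
  rw [← inf_inf_distrib_right, h, bot_inf_eq]

theorem IsAdditive.eq_add {f : B → ℝ} (hf : IsAdditive f) {x y : B} (h : x ≤ y) :
    f y = f x + f (y ⊓ xᶜ) := by
  rw [← hf _ _ (by rw [inf_left_comm, inf_compl_self, inf_bot_eq]), sup_inf_left, sup_compl_eq_top,
    inf_top_eq, sup_eq_right.mpr h]

open Classical in
theorem IsAdditive.eq_sum_atoms [Finite B] [Fintype (Atoms B)] {f : B → ℝ} (hf : IsAdditive f)
    (a : B) : f a = ∑ α : Atoms B, if (α : B) ≤ a then f α else 0 := by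
  induction a using induction_atoms with
  | bot =>
    rw [hf.map_bot, Finset.sum_eq_zero]
    exact fun α _ => if_neg fun h => α.2.1 (le_bot_iff.mp h)
  | sup β a hβ ih =>
    have hd : a ⊓ β = ⊥ := by
      rw [inf_comm]
      exact (β.2.not_le_iff_disjoint.mp hβ).eq_bot
    have h : ∀ α : Atoms B, (if (α : B) ≤ a ⊔ β then f α else 0) =
        (if (α : B) ≤ a then f α else 0) + if α = β then f β else 0 := by
      intro α
      have hαβ : (α : B) ≤ β ↔ α = β := by
        rw [β.2.le_iff_eq α.2.1, Subtype.ext_iff]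
      rw [atom_le_sup_iff α.2, hαβ]
      by_cases e : α = β
      · subst e
        simp [hβ]
      · simp [e]
    rw [hf _ _ hd, ih, Finset.sum_congr rfl fun α _ => h α, Finset.sum_add_distrib]
    simp

end Additive

section Extension

variable {A : Type*} [BooleanAlgebra A]

theorem IsPositiveProb.isAdditive {P : A → ℝ} (hP : IsPositiveProb P) : IsAdditive P := hP.map_sup

theorem seqWeight_pos {P : A → ℝ} (hP : IsPositiveProb P) {k : ℕ} (s : AtomSeq A k) :
    0 < seqWeight P s := by
  refine Finset.prod_pos fun i _ => div_pos ?_ (hP.pos _ (before_ne_bot s i))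
  rw [inf_eq_left.mpr (le_before s i)]
  exact hP.pos _ (s i).2.1

variable [Finite A]

-- Law of total probability: `a ↦ f (cond a b ⊓ x)` is additive on `A` because `cond · b` preserves
-- joins and `⊥`, so its value at `b` is a sum over atoms.
open Classical in
theorem IsAdditive.eq_sum_cond [Fintype (Atoms A)] {f : Cond A → ℝ} (hf : IsAdditive f)
    (x : Cond A) (b : {b : A // b ≠ ⊥}) :
    f x = ∑ α : Atoms A, if (α : A) ≤ b.1 then f (cond (α : A) b ⊓ x) else 0 := by
  have hg : IsAdditive fun a : A => f (cond a b ⊓ x) := by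
    intro a a' h
    change f (cond (a ⊔ a') b ⊓ x) = _
    rw [cond_sup]
    exact hf.comp_inf x _ _ (by rw [← cond_inf, h, cond_bot])
  rw [← hg.eq_sum_atoms b.1, cond_self, top_inf_eq]

open Classical in
theorem canonicalExtension_eq_sum [Fintype (FullSeq A)] (P : A → ℝ) (t : Cond A) :
    canonicalExtension P t = ∑ s : FullSeq A, if omega s ≤ t then seqWeight P s else 0 := by
  have h : {ω : Cond A | IsAtom ω ∧ ω ≤ t} =
      (fun s : FullSeq A => omega s) '' {s | omega s ≤ t} := by
    ext ω
    constructor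
    · rintro ⟨hω, hle⟩
      obtain ⟨s, -, rfl⟩ := bijOn_omega.surjOn hω
      exact ⟨s, hle, rfl⟩
    · rintro ⟨s, hs, rfl⟩
      exact ⟨isAtom_omega s, hs⟩
  rw [canonicalExtension, h, finsum_mem_image omega_injective.injOn, finsum_mem_def,
    finsum_eq_sum_of_fintype]
  refine Finset.sum_congr rfl fun s _ => ?_
  rw [Set.indicator_apply]
  exact if_congr Iff.rfl (omega_injective.extend_apply _ _ s) rfl

theorem isAdditive_canonicalExtension (P : A → ℝ) : IsAdditive (canonicalExtension P) := by
  classical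
  have := Fintype.ofFinite (FullSeq A)
  intro x y h
  rw [canonicalExtension_eq_sum, canonicalExtension_eq_sum, canonicalExtension_eq_sum,
    ← Finset.sum_add_distrib]
  refine Finset.sum_congr rfl fun s _ => ?_
  rw [atom_le_sup_iff (isAtom_omega s)]
  by_cases hx : omega s ≤ x
  · have hy : ¬ omega s ≤ y := fun hy => omega_ne_bot s (le_bot_iff.mp (h ▸ le_inf hx hy))
    simp [hx, hy]
  · simp [hx]

theorem canonicalExtension_omega_full (P : A → ℝ) (s : FullSeq A) :
    canonicalExtension P (omega s) = seqWeight P s := by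
  classical
  have := Fintype.ofFinite (FullSeq A)
  have h : ∀ t : FullSeq A, omega t ≤ omega s ↔ t = s := fun t => by
    rw [(isAtom_omega s).le_iff_eq (omega_ne_bot t)]
    exact omega_injective.eq_iff
  simp [canonicalExtension_eq_sum, h]

variable {P : A → ℝ}

/-- Appending `α` multiplies the weight by `P α / P (rest s)`, and these factors sum to `1` over the
atoms below `rest s`. -/
theorem canonicalExtension_omega (hP : IsPositiveProb P) {k : ℕ}
    (hk : k ≤ Nat.card (Atoms A) - 1) (s : AtomSeq A k) :
    canonicalExtension P (omega s) = seqWeight P s := by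
  classical
  have := Fintype.ofFinite (Atoms A)
  induction hk using Nat.decreasingInduction with
  | self => exact canonicalExtension_omega_full P s
  | of_succ k hk ih =>
    have hs : rest s ≠ ⊥ := rest_ne_bot s (by omega)
    have hterm : ∀ α : Atoms A,
        (if (α : A) ≤ rest s then canonicalExtension P (cond (α : A) ⟨rest s, hs⟩ ⊓ omega s)
          else 0) = seqWeight P s / P (rest s) * if (α : A) ≤ rest s then P α else 0 := by
      intro α
      split_ifs with hα
      · rw [inf_comm, ← omega_snoc s α hα hs, ih, seqWeight_snoc]
        ring
      · rw [mul_zero]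
    rw [(isAdditive_canonicalExtension P).eq_sum_cond _ ⟨rest s, hs⟩,
      Finset.sum_congr rfl fun α _ => hterm α, ← Finset.mul_sum, ← hP.isAdditive.eq_sum_atoms,
      div_mul_cancel₀ _ (hP.pos _ hs).ne']

/-- As long as the prefix avoids `b`, it carries no information on `(a | b)`. The next atom either
falls below `b` and decides the conditional, or leaves the situation unchanged with a longer prefix.
-/
theorem canonicalExtension_cond_inf_omega (hP : IsPositiveProb P) {k : ℕ}
    (hk : k ≤ Nat.card (Atoms A) - 1) (s : AtomSeq A k) (a : A) (b : {b : A // b ≠ ⊥})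
    (hb : b.1 ≤ rest s) :
    canonicalExtension P (cond a b ⊓ omega s) = seqWeight P s * (P (a ⊓ b.1) / P b.1) := by
  classical
  have := Fintype.ofFinite (Atoms A)
  have hPb := (hP.pos _ b.2).ne'
  have hμ := isAdditive_canonicalExtension P
  induction hk using Nat.decreasingInduction with
  | self =>
    have hat : IsAtom b.1 := isAtom_of_le_rest s b.2 hb
    by_cases hba : b.1 ≤ a
    · rw [cond_eq_top hba, top_inf_eq, canonicalExtension_omega_full, inf_eq_right.mpr hba,
        div_self hPb, mul_one]
    · have h : a ⊓ b.1 = ⊥ := by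
        rw [inf_comm]
        exact (hat.not_le_iff_disjoint.mp hba).eq_bot
      rw [cond_eq_bot h, bot_inf_eq, h, hμ.map_bot, hP.isAdditive.map_bot, zero_div, mul_zero]
  | of_succ k hk ih =>
    have hs : rest s ≠ ⊥ := rest_ne_bot s (by omega)
    set c := P (a ⊓ b.1) / P b.1 with hc
    -- On an atom this collects all cases: mass `P α` if it lies below `a ⊓ b`, none if below `b`
    -- only, and `P α * c` from the induction hypothesis if outside `b`. Being additive, it sums
    -- over atoms to its value at `rest s`.
    have hg : IsAdditive fun x => P (x ⊓ (a ⊓ b.1)) + P (x ⊓ b.1ᶜ) * c := by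
      intro x y h
      have h₁ := hP.isAdditive.comp_inf (a ⊓ b.1) x y h
      have h₂ := hP.isAdditive.comp_inf b.1ᶜ x y h
      simp only at h₁ h₂ ⊢
      rw [h₁, h₂]
      ring
    have hterm : ∀ α : Atoms A,
        (if (α : A) ≤ rest s then
          canonicalExtension P (cond (α : A) ⟨rest s, hs⟩ ⊓ (cond a b ⊓ omega s)) else 0) =
        seqWeight P s / P (rest s) *
          if (α : A) ≤ rest s then P (α ⊓ (a ⊓ b.1)) + P (α ⊓ b.1ᶜ) * c else 0 := by
      intro α
      split_ifs with hα
      · have e : cond (α : A) ⟨rest s, hs⟩ ⊓ (cond a b ⊓ omega s) =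
            cond a b ⊓ omega (snoc s α hα) := by
          rw [omega_snoc s α hα hs, inf_left_comm, inf_comm (omega s)]
        rw [e]
        by_cases hαb : (α : A) ≤ b.1
        · have hle : omega (snoc s α hα) ≤ cond (α : A) b := by
            rw [omega_snoc s α hα hs]
            exact inf_le_right.trans (cond_antitone hαb hb)
          have h₀ : (α : A) ⊓ b.1ᶜ = ⊥ := (disjoint_compl_right.mono_left hαb).eq_bot
          rw [h₀, hP.isAdditive.map_bot, zero_mul, add_zero]
          by_cases hαa : (α : A) ≤ a
          · rw [inf_eq_right.mpr (hle.trans (cond_mono hαa b)),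
              canonicalExtension_omega hP (by omega), seqWeight_snoc,
              inf_eq_left.mpr (le_inf hαa hαb)]
            ring
          · have hd : (α : A) ⊓ a = ⊥ := (α.2.not_le_iff_disjoint.mp hαa).eq_bot
            have h : cond a b ⊓ omega (snoc s α hα) = ⊥ := by
              refine le_bot_iff.mp ((inf_le_inf_left _ hle).trans ?_)
              rw [← cond_inf, inf_comm, hd, cond_bot]
            rw [h, hμ.map_bot, ← inf_assoc, hd, bot_inf_eq, hP.isAdditive.map_bot, mul_zero]
        · have hd : (α : A) ⊓ b.1 = ⊥ := (α.2.not_le_iff_disjoint.mp hαb).eq_bot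
          have hb' : b.1 ≤ rest (snoc s α hα) := by
            rw [rest_snoc]
            exact le_inf hb (le_compl_iff_disjoint_left.mpr (disjoint_iff.mpr hd))
          rw [ih _ hb', seqWeight_snoc, inf_left_comm, hd, inf_bot_eq, hP.isAdditive.map_bot,
            inf_eq_left.mpr ((atom_le_compl_iff_not_le α.2 b.1).mpr hαb)]
          ring
      · rw [mul_zero]
    rw [hμ.eq_sum_cond _ ⟨rest s, hs⟩, Finset.sum_congr rfl fun α _ => hterm α,
      ← Finset.mul_sum, ← hg.eq_sum_atoms, inf_eq_right.mpr (inf_le_right.trans hb)]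
    have hPr := (hP.pos _ hs).ne'
    -- The sum is `P (a ⊓ b) + P (rest s ⊓ bᶜ) * c`; writing the first term as `P b * c` collapses
    -- it to `P (rest s) * c`.
    have h₁ : P (a ⊓ b.1) = P b.1 * c := by
      rw [hc, mul_div_cancel₀ _ hPb]
    rw [h₁, mul_comm (P b.1), mul_comm _ c, ← mul_add, ← hP.isAdditive.eq_add hb]
    field_simp

theorem canonicalExtension_cond (hP : IsPositiveProb P) (a : A) (b : {b : A // b ≠ ⊥}) :
    canonicalExtension P (cond a b) = P (a ⊓ b.1) / P b.1 := by
  have h := canonicalExtension_cond_inf_omega hP (Nat.zero_le _)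
    ⟨Fin.elim0, fun i => i.elim0⟩ a b (by rw [rest_zero]; exact le_top)
  rw [omega_zero, inf_top_eq] at h
  simpa [seqWeight] using h

theorem isPositiveProb_canonicalExtension (hP : IsPositiveProb P) :
    IsPositiveProb (canonicalExtension P) := by
  classical
  have := Fintype.ofFinite (FullSeq A)
  have hadd := isAdditive_canonicalExtension P
  have htop : canonicalExtension P ⊤ = 1 := by
    have h := canonicalExtension_omega hP (Nat.zero_le _) ⟨Fin.elim0, fun i => i.elim0⟩
    rw [omega_zero] at h
    simpa [seqWeight] using h
  have hnonneg : ∀ t, 0 ≤ canonicalExtension P t := fun t => by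
    rw [canonicalExtension_eq_sum]
    refine Finset.sum_nonneg fun s _ => ?_
    split_ifs
    exacts [(seqWeight_pos hP s).le, le_rfl]
  refine ⟨fun t => ⟨hnonneg t, ?_⟩, htop, hadd, fun t ht => ?_⟩
  · have h := hadd.eq_add (le_top (a := t))
    have h' := hnonneg (⊤ ⊓ tᶜ)
    linarith
  · obtain ⟨s, hs⟩ := exists_omega_le ht
    rw [hadd.eq_add hs, canonicalExtension_omega_full]
    exact add_pos_of_pos_of_nonneg (seqWeight_pos hP s) (hnonneg _)

end Extension

end CondAlg

theorem theorem6p9 {A : Type*} [BooleanAlgebra A] [Finite A]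
    (P : A → ℝ) (hP : CondAlg.IsPositiveProb P) :
    -- the algebra of conditionals is finite
    Finite (CondAlg.Cond A) ∧
    -- the `omega s` are exactly its atoms, each for one sequence `s`
    Set.BijOn (fun s : CondAlg.FullSeq A => CondAlg.omega s) Set.univ
      {ω : CondAlg.Cond A | IsAtom ω} ∧
    -- the canonical extension is a positive probability with the prescribed values on atoms
    CondAlg.IsPositiveProb (CondAlg.canonicalExtension P) ∧
    (∀ s : CondAlg.FullSeq A,
      CondAlg.canonicalExtension P (CondAlg.omega s) = CondAlg.seqWeight P s) ∧
    -- it agrees with the conditional probability on basic conditionals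
    ∀ (a : A) (b : {b : A // b ≠ ⊥}),
      CondAlg.canonicalExtension P (CondAlg.cond a b) = P (a ⊓ b.1) / P b.1 :=
  ⟨CondAlg.finite_cond, CondAlg.bijOn_omega, CondAlg.isPositiveProb_canonicalExtension hP,
    CondAlg.canonicalExtension_omega_full P, CondAlg.canonicalExtension_cond hP⟩
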